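/- Let $\mathbf{C}=\{0,1\}^{\mathbb N}$ be Cantor space with the product topology; for $A\in\mathbf{C}$ let $A\upharpoonright n$ denote the string of the first $n$ bits of $A$. A function $d:\{0,1\}^*\to[0,\infty)$ is a martingale if $2d(w)=d(w0)+d(w1)$ for all strings $w$, and a supermartingale if $2d(w)\ge d(w0)+d(w1)$ for all $w$. Its success set is $S^\infty[d]=\{A\in\mathbf{C} : \limsup_{n\to\infty} d(A\upharpoonright n)=\infty\}$. The function $d$ is computable if there is a computable $f:\{0,1\}^*\times\mathbb N\to\mathbb N$ with $|f(w,n)/2^n-d(w)|\le 2^{-n}$ for all $w,n$. A sequence $A$ is computably random if $A\notin S^\infty[d]$ for every computable martingale $d$; let $\mathrm{RAND}_{\mathrm{comp}}$ be the class of all computably random sequences. A class $\mathcal X\subseteq\mathbf{C}$ is (lightface) $\Pi^0_3$ if there is a decidable predicate $P$ such that, for all $A\in\mathbf{C}$, $A\in\mathcal X\iff(\forall k_3)(\exists k_2)(\forall k_1)\,P(k_3,k_2,A\upharpoonright k_1)$, where the quantifiers range over $\mathbb N$. It is boldface $\mathbf{\Sigma}^0_3$ if it belongs to the third additive level of the Borel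 hierarchy of $\mathbf{C}$, where $\mathbf{\Sigma}^0_1$ consists of the open sets and $\mathbf{\Sigma}^0_{n+1}$ of the countable unions of complements of $\mathbf{\Sigma}^0_n$ sets. Theorem. The class $\mathrm{RAND}_{\mathrm{comp}}$ is a $\Pi^0_3$-class, but it is not a $\mathbf{\Sigma}^0_3$-class. Consequently, $\mathrm{RAND}_{\mathrm{comp}}\neq\mathbf{C}\setminus S^\infty[d]$ for every (arbitrarily noncomputable) supermartingale $d$. -/

import Mathlib

open scoped NNReal ENNReal

/-! ### Cantor space, martingales and success sets -/

/-- Cantor space: infinite binary sequences, with the product of the discrete topologies. -/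
abbrev Cantor : Type := ℕ → Bool

/-- The string consisting of the first `n` bits of the sequence `A`. -/
def Cantor.restr (A : Cantor) (n : ℕ) : List Bool := (List.range n).map A

/-- `d : {0,1}* → [0,∞)` is a martingale: `2 d(w) = d(w0) + d(w1)` for every string `w`. -/
def IsMartingale (d : List Bool → ℝ≥0) : Prop :=
  ∀ w : List Bool, 2 * d w = d (w ++ [false]) + d (w ++ [true])

/-- `d : {0,1}* → [0,∞)` is a supermartingale: `2 d(w) ≥ d(w0) + d(w1)` for every string `w`. -/
def IsSupermartingale (d : List Bool → ℝ≥0) : Prop :=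
  ∀ w : List Bool, d (w ++ [false]) + d (w ++ [true]) ≤ 2 * d w

/-- The success set of `d`: the sequences `A` with `limsup_n d(A↾n) = ∞`. -/
def successSet (d : List Bool → ℝ≥0) : Set Cantor :=
  {A | Filter.limsup (fun n : ℕ => (d (A.restr n) : ℝ≥0∞)) Filter.atTop = ⊤}

/-- A function `d : {0,1}* → [0,∞)` is computable if there is an algorithm which, given a string
`w` and a precision `n`, outputs a numerator `m` such that the dyadic rational `m / 2^n` is within
`2^(-n)` of `d w`. As `d w ≥ 0`, natural numerators suffice. -/
def IsComputableFun (d : List Bool → ℝ≥0) : Prop :=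
  ∃ f : List Bool → ℕ → ℕ, Computable₂ f ∧
    ∀ (w : List Bool) (n : ℕ), |(f w n : ℝ) / 2 ^ n - (d w : ℝ)| ≤ 1 / 2 ^ n

/-- A sequence is computably random if no computable martingale succeeds on it. -/
def ComputablyRandom (A : Cantor) : Prop :=
  ∀ d : List Bool → ℝ≥0, IsMartingale d → IsComputableFun d → A ∉ successSet d

/-- The class of all computably random sequences. -/
def RANDcomp : Set Cantor := {A | ComputablyRandom A}

/-! ### The boldface (Borel) hierarchy -/

/-- The boldface class `Σ⁰ₙ` of subsets of a space (meaningful for `n ≥ 1`): `Σ⁰₁` consists of the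
open sets, and `Σ⁰ₙ₊₁` of the countable unions of sets whose complements are in `Σ⁰ₙ`, that is, of
`Π⁰ₙ` sets. -/
def BoldSigma {X : Type*} [TopologicalSpace X] : ℕ → Set X → Prop
  | 0, _ => False
  | 1, S => IsOpen S
  | n + 2, S => ∃ T : ℕ → Set X, (∀ i, BoldSigma (n + 1) (T i)ᶜ) ∧ S = ⋃ i, T i

/-! ### The lightface (arithmetical) hierarchy of classes of sequences -/

mutual

/-- `SigmaForm P A n ks` is `(∃ kₙ) (∀ kₙ₋₁) ⋯ (Q k₁) P(ks, kₙ, …, k₂, A↾k₁)`, an alternating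
prefix of `n` quantifiers over natural numbers, the first one existential (meaningful for
`n ≥ 1`). -/
def SigmaForm (P : List ℕ → List Bool → Prop) (A : Cantor) : ℕ → List ℕ → Prop
  | 0, _ => False
  | 1, ks => ∃ k : ℕ, P ks (A.restr k)
  | n + 2, ks => ∃ k : ℕ, PiForm P A (n + 1) (ks ++ [k])

/-- `PiForm P A n ks` is `(∀ kₙ) (∃ kₙ₋₁) ⋯ (Q k₁) P(ks, kₙ, …, k₂, A↾k₁)`, an alternating
prefix of `n` quantifiers over natural numbers, the first one universal (meaningful for
`n ≥ 1`). -/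
def PiForm (P : List ℕ → List Bool → Prop) (A : Cantor) : ℕ → List ℕ → Prop
  | 0, _ => False
  | 1, ks => ∀ k : ℕ, P ks (A.restr k)
  | n + 2, ks => ∀ k : ℕ, SigmaForm P A (n + 1) (ks ++ [k])

end

/-- The lightface class `Π⁰ₙ` of the arithmetical hierarchy of classes of sequences (for `n ≥ 1`):
for some decidable predicate `P`,
`A ∈ S ↔ (∀ kₙ) (∃ kₙ₋₁) ⋯ (Q k₁) P(kₙ, …, k₂, A↾k₁)`. -/
def LightPi (n : ℕ) (S : Set Cantor) : Prop :=
  ∃ P : List ℕ → List Bool → Prop,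
    ComputablePred (fun p : List ℕ × List Bool => P p.1 p.2) ∧
      ∀ A : Cantor, A ∈ S ↔ PiForm P A n []

/-!
Computable randomness is `Π⁰₃` because it says that each program `e` either fails to compute a
martingale or computes one that is bounded along the sequence. Dyadic approximations computed by
`e` come from a martingale if and only if they all converge and satisfy decidable constraints up to
rounding errors (`exists_codesFun_of_forall_checkedAt`), so failure is a `Σ⁰₂` condition; and so is
boundedness. With step-bounded evaluation this becomes `mem_RANDcomp_iff`.

That the class is not boldface `Σ⁰₃` is a fusion argument over conditions `(D, s)`, with `D` a
computable martingale and `s` a string: the condition stands for the closed class `roomClass D s`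
of the extensions of `s` along which `D` stays below a fixed bound, with a reserve that vanishes
with the length. The reserve pays for the inexactness of computing which of the two next bits is
the better one, so that a computable next-bit rule never leads out of the class
(`exists_computable_rule`). Two kinds of requirements can be met by strengthening a condition.

* A computable martingale `d` is kept bounded by replacing `D` by `D + d / 2 ^ k`
  (`exists_roomClass_bounded`).
* A `Gδ` class `T` of computably random sequences is avoided (`exists_roomClass_disjoint`). If no
  stronger string does so, then `T` is dense in `roomClass D s`, and by Baire category it contains a
  sequence which obeys the rule on the interval `[n, 3n)` for infinitely many `n`. On this sequence
  a computable martingale betting on the rule succeeds: the sum over `m` of the martingales that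
  start with `2⁻ᵐ` and always bet everything on the rule from position `m` on.

If `RANDcomp` were a union of `Gδ` classes `T i`, then fusion would give a sequence on which
all computable martingales are bounded and which lies in no `T i`. Finally, the complement of the
success set of any function `d` is a countable union of closed classes, hence `Σ⁰₃`, so it differs
from `RANDcomp`.
-/

/-! ### Initial segments and the topology of Cantor space -/

namespace Cantor

@[simp] lemma length_restr (A : Cantor) (n : ℕ) : (A.restr n).length = n := by
  simp [restr]

lemma restr_succ (A : Cantor) (n : ℕ) : A.restr (n + 1) = A.restr n ++ [A n] := by
  simp [restr, List.range_succ]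

lemma restr_eq_restr_iff {A B : Cantor} {n : ℕ} :
    A.restr n = B.restr n ↔ ∀ i < n, A i = B i := by
  simp [restr]

lemma restr_eq_of_le {A B : Cantor} {m n : ℕ} (hmn : m ≤ n) (h : A.restr n = B.restr n) :
    A.restr m = B.restr m :=
  restr_eq_restr_iff.2 fun i hi => restr_eq_restr_iff.1 h i (hi.trans_le hmn)

lemma take_restr (A : Cantor) (m n : ℕ) : (A.restr n).take m = A.restr (min m n) := by
  simp [restr, ← List.map_take, List.take_range]

lemma isOpen_restr_mem (P : List Bool → Prop) (n : ℕ) : IsOpen {A : Cantor | P (A.restr n)} := by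
  rw [isOpen_iff_mem_nhds]
  intro A hA
  have hU : IsOpen (⋂ i ∈ Finset.range n, {B : Cantor | B i = A i}) :=
    isOpen_biInter_finset fun i _ =>
      (isOpen_discrete {A i}).preimage (continuous_apply (A := fun _ : ℕ => Bool) i)
  refine Filter.mem_of_superset (hU.mem_nhds (by simp)) fun B hB => ?_
  have : B.restr n = A.restr n := restr_eq_restr_iff.2 (by simpa using hB)
  simpa [this] using hA

lemma isClosed_restr_mem (P : List Bool → Prop) (n : ℕ) :
    IsClosed {A : Cantor | P (A.restr n)} :=
  ⟨isOpen_restr_mem (fun w => ¬ P w) n⟩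

lemma exists_restr_eq_subset {U : Set Cantor} (hU : IsOpen U) {A : Cantor} (hA : A ∈ U) :
    ∃ n, ∀ B : Cantor, B.restr n = A.restr n → B ∈ U := by
  obtain ⟨I, u, hu, hIU⟩ := isOpen_pi_iff.1 hU A hA
  refine ⟨I.sup id + 1, fun B hB => hIU fun i hi => ?_⟩
  have hi' : i < I.sup id + 1 := Nat.lt_succ_of_le (Finset.le_sup (f := id) hi)
  rw [restr_eq_restr_iff.1 hB i hi']
  exact (hu i hi).2

/-- The initial segments of the sequence obtained by iterating the next-bit rule `g`. -/
def followPrefix (g : List Bool → Bool) : ℕ → List Bool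
  | 0 => []
  | n + 1 => followPrefix g n ++ [g (followPrefix g n)]

/-- Every next-bit rule is obeyed by a sequence. -/
lemma exists_forall_apply_eq (g : List Bool → Bool) : ∃ A : Cantor, ∀ n, A n = g (A.restr n) := by
  refine ⟨fun n => g (followPrefix g n), fun n => ?_⟩
  have key : ∀ n, restr (fun n => g (followPrefix g n)) n = followPrefix g n := by
    intro n
    induction n with
    | zero => rfl
    | succ n ih => rw [restr_succ, ih, followPrefix]
  rw [key]

/-- Every string can be prolonged by a sequence which obeys a given next-bit rule from then on. -/
lemma exists_restr_eq_and_apply_eq (s : List Bool) (b : List Bool → Bool) :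
    ∃ A : Cantor, A.restr s.length = s ∧ ∀ n, s.length ≤ n → A n = b (A.restr n) := by
  obtain ⟨A, hA⟩ := exists_forall_apply_eq
    fun w => if w.length < s.length then s.getD w.length false else b w
  refine ⟨A, ?_, fun n hn => by rw [hA]; simp [hn]⟩
  refine List.ext_getElem (by simp) fun i h₁ h₂ => ?_
  have := hA i
  rw [length_restr, if_pos h₂] at this
  simp [restr, this, h₂]

end Cantor

/-- A `limsup` of finite values is infinite exactly if the values are unbounded. -/
lemma mem_successSet_iff {d : List Bool → ℝ≥0} {A : Cantor} :
    A ∈ successSet d ↔ ∀ k : ℕ, ∃ n, (k : ℝ≥0) < d (A.restr n) := by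
  constructor
  · intro h k
    by_contra! hk
    have h1 : Filter.limsup (fun n : ℕ => (d (A.restr n) : ℝ≥0∞)) Filter.atTop ≤ (k : ℝ≥0∞) :=
      Filter.limsup_le_of_le (h := Filter.Eventually.of_forall fun n => by exact_mod_cast hk n)
    rw [show Filter.limsup (fun n : ℕ => (d (A.restr n) : ℝ≥0∞)) Filter.atTop = ⊤ from h] at h1
    exact absurd h1 (by simp)
  · intro h
    by_contra hne
    have hlt : Filter.limsup (fun n : ℕ => (d (A.restr n) : ℝ≥0∞)) Filter.atTop < ⊤ :=
      lt_top_iff_ne_top.2 hne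
    obtain ⟨c, hc1, hc2⟩ := ENNReal.lt_iff_exists_nnreal_btwn.1 hlt
    have hev := Filter.eventually_lt_of_limsup_lt hc1
    obtain ⟨N, hN⟩ := Filter.eventually_atTop.1 hev
    obtain ⟨k, hk⟩ := exists_nat_ge (c + ∑ i ∈ Finset.range N, d (A.restr i))
    obtain ⟨n, hn⟩ := h k
    refine absurd (hn.trans_le' hk) (not_lt.2 ?_)
    rcases lt_or_ge n N with h' | h'
    · exact (Finset.single_le_sum (f := fun i => d (A.restr i)) (fun _ _ => zero_le)
        (Finset.mem_range.2 h')).trans le_add_self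
    · exact (ENNReal.coe_lt_coe.1 (hN n h')).le.trans le_self_add

/-- A fusion argument: if each of countably many requirements can be met by shrinking the set of
the current condition, then some sequence in the set of the initial condition meets them all. -/
lemma exists_mem_of_forall_refine {X Y : Type*} [TopologicalSpace Y] (K : X → Set Y)
    (hne : ∀ p, (K p).Nonempty) (hcl : ∀ p, IsClosed (K p)) (hco : ∀ p, IsCompact (K p))
    (W : ℕ → Set Y) (step : ∀ j p, ∃ q, K q ⊆ K p ∧ K q ⊆ W j) (p : X) :
    ∃ A ∈ K p, ∀ j, A ∈ W j := by
  choose next h1 h2 using step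
  let q : ℕ → X := fun n => Nat.rec p (fun j r => next j r) n
  obtain ⟨A, hA⟩ := IsCompact.nonempty_iInter_of_sequence_nonempty_isCompact_isClosed
    (fun n => K (q n)) (fun n => h1 n (q n)) (fun n => hne _) (hco _) (fun n => hcl _)
  rw [Set.mem_iInter] at hA
  exact ⟨A, hA 0, fun j => h2 j (q j) (hA (j + 1))⟩

/-! ### Computable martingales -/

lemma primrec_two_pow : Primrec fun n : ℕ => 2 ^ n :=
  (Primrec₂.unpaired'.1 Nat.Primrec.pow).comp (Primrec.const 2) Primrec.id

lemma isMartingale_zero : IsMartingale fun _ => 0 := fun _ => by simp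

lemma isComputableFun_zero : IsComputableFun fun _ => 0 :=
  ⟨fun _ _ => 0, Computable.const 0, fun w n => by simp⟩

lemma IsMartingale.add_div {D d : List Bool → ℝ≥0} (hD : IsMartingale D) (hd : IsMartingale d)
    (c : ℝ≥0) : IsMartingale fun w => D w + d w / c := by
  intro w
  calc 2 * (D w + d w / c) = 2 * D w + 2 * d w / c := by ring
    _ = _ := by rw [hD w, hd w]; ring

lemma IsComputableFun.add_div_two_pow {D d : List Bool → ℝ≥0} (hD : IsComputableFun D)
    (hd : IsComputableFun d) (k : ℕ) : IsComputableFun fun w => D w + d w / 2 ^ k := by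
  obtain ⟨f, hf, hfD⟩ := hD
  obtain ⟨g, hg, hgd⟩ := hd
  -- Adding half of the divisor rounds the quotient to a nearest integer.
  refine ⟨fun w n => (2 ^ k * f w (n + 2) + g w (n + 2) + 2 ^ (k + 1)) / 2 ^ (k + 2), ?_, ?_⟩
  · have hs : Computable fun p : List Bool × ℕ => p.2 + 2 :=
      (Primrec.nat_add.comp Primrec.snd (Primrec.const 2)).to_comp
    have h1 : Computable fun p : List Bool × ℕ => f p.1 (p.2 + 2) := hf.comp Computable.fst hs
    have h2 : Computable fun p : List Bool × ℕ => g p.1 (p.2 + 2) := hg.comp Computable.fst hs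
    exact Primrec.nat_div.to_comp.comp
      (Primrec.nat_add.to_comp.comp
        (Primrec.nat_add.to_comp.comp
          (Primrec.nat_mul.to_comp.comp (Computable.const (2 ^ k)) h1) h2)
        (Computable.const (2 ^ (k + 1))))
      (Computable.const (2 ^ (k + 2)))
  · intro w n
    set N := 2 ^ k * f w (n + 2) + g w (n + 2) + 2 ^ (k + 1) with hN
    set a : ℝ := ((f w (n + 2) : ℕ) : ℝ)
    set b : ℝ := ((g w (n + 2) : ℕ) : ℝ)
    have hNr : (N : ℝ) = 2 ^ k * a + b + 2 ^ (k + 1) := by rw [hN]; push_cast; rfl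
    have hk : (0 : ℝ) < 2 ^ k := by positivity
    have hn : (0 : ℝ) < 2 ^ n := by positivity
    have hk1 : (1 : ℝ) ≤ 2 ^ k := one_le_pow₀ one_le_two
    have e1 : ((N / 2 ^ (k + 2) : ℕ) : ℝ) * 2 ^ (k + 2) ≤ N := by
      exact_mod_cast Nat.div_mul_le_self N (2 ^ (k + 2))
    have e2 : (N : ℝ) < ((N / 2 ^ (k + 2) : ℕ) : ℝ) * 2 ^ (k + 2) + 2 ^ (k + 2) := by
      exact_mod_cast Nat.lt_div_mul_add (a := N) (b := 2 ^ (k + 2)) (by positivity)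
    set q : ℝ := ((N / 2 ^ (k + 2) : ℕ) : ℝ)
    rw [hNr] at e1 e2
    have hD1 : |a - 4 * 2 ^ n * D w| ≤ 1 := by
      have : a - 4 * 2 ^ n * D w = (a / 2 ^ (n + 2) - D w) * 2 ^ (n + 2) := by
        field_simp; ring
      rw [this, abs_mul, abs_of_pos (a := (2 : ℝ) ^ (n + 2)) (by positivity)]
      calc _ ≤ 1 / 2 ^ (n + 2) * (2 : ℝ) ^ (n + 2) := by gcongr; exact hfD w (n + 2)
        _ = 1 := by field_simp
    have hd1 : |b - 4 * 2 ^ n * d w| ≤ 1 := by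
      have : b - 4 * 2 ^ n * d w = (b / 2 ^ (n + 2) - d w) * 2 ^ (n + 2) := by
        field_simp; ring
      rw [this, abs_mul, abs_of_pos (a := (2 : ℝ) ^ (n + 2)) (by positivity)]
      calc _ ≤ 1 / 2 ^ (n + 2) * (2 : ℝ) ^ (n + 2) := by gcongr; exact hgd w (n + 2)
        _ = 1 := by field_simp
    obtain ⟨i1, i2⟩ := abs_le.1 hD1
    obtain ⟨i3, i4⟩ := abs_le.1 hd1
    have i1' := mul_le_mul_of_nonneg_left i1 hk.le
    have i2' := mul_le_mul_of_nonneg_left i2 hk.le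
    have key : q / 2 ^ n - (D w + d w / 2 ^ k) =
        (q * (4 * 2 ^ k) - (4 * 2 ^ n * D w * 2 ^ k + 4 * 2 ^ n * d w)) / (4 * 2 ^ k * 2 ^ n) := by
      field_simp
    have p1 : (2 : ℝ) ^ (k + 1) = 2 * 2 ^ k := by ring
    have p2 : (2 : ℝ) ^ (k + 2) = 4 * 2 ^ k := by ring
    have e1' : q * (4 * 2 ^ k) ≤ 2 ^ k * a + b + 2 * 2 ^ k := by
      rw [p1, p2] at e1; linarith
    have e2' : 2 ^ k * a + b + 2 * 2 ^ k < q * (4 * 2 ^ k) + 4 * 2 ^ k := by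
      rw [p1, p2] at e2; linarith
    push_cast
    rw [key, abs_div, abs_of_pos (a := 4 * (2 : ℝ) ^ k * 2 ^ n) (by positivity),
      div_le_div_iff₀ (by positivity) hn, ← mul_assoc, one_mul]
    gcongr
    rw [abs_le]
    constructor <;> nlinarith

/-- Against a computable martingale `D` there is a computable next-bit rule along which `D` grows
by an arbitrarily small amount: compare approximations to the two possible next values. -/
lemma exists_computable_rule {D : List Bool → ℝ≥0} (hD : IsMartingale D)
    (hc : IsComputableFun D) : ∃ b : List Bool → Bool, Computable b ∧
      ∀ w, (D (w ++ [b w]) : ℝ) ≤ D w + 2 / 2 ^ w.length := by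
  obtain ⟨f, hf, hfD⟩ := hc
  refine ⟨fun w => decide (f (w ++ [true]) w.length < f (w ++ [false]) w.length), ?_, ?_⟩
  · have h : ∀ x : Bool, Computable fun w : List Bool => f (w ++ [x]) w.length := fun x =>
      hf.comp (Computable.list_concat.comp Computable.id (Computable.const x))
        Computable.list_length
    exact (Primrec.nat_lt.decide.to_comp).comp ((h true)) (h false)
  · intro w
    have hm : 2 * (D w : ℝ) = D (w ++ [false]) + D (w ++ [true]) := by exact_mod_cast hD w
    obtain ⟨h1, h2⟩ := abs_le.1 (hfD (w ++ [false]) w.length)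
    obtain ⟨h3, h4⟩ := abs_le.1 (hfD (w ++ [true]) w.length)
    have h2n : (0 : ℝ) < 2 ^ w.length := by positivity
    rw [show (2 : ℝ) / 2 ^ w.length = 2 * (1 / 2 ^ w.length) by ring]
    by_cases hlt : f (w ++ [true]) w.length < f (w ++ [false]) w.length
    · have : (f (w ++ [true]) w.length : ℝ) / 2 ^ w.length ≤
          f (w ++ [false]) w.length / 2 ^ w.length := by
        gcongr
      simp only [hlt, decide_true]
      linarith
    · have : (f (w ++ [false]) w.length : ℝ) / 2 ^ w.length ≤
          f (w ++ [true]) w.length / 2 ^ w.length := by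
        gcongr; exact not_lt.1 hlt
      simp only [hlt, decide_false]
      linarith

/-! ### A martingale betting on long stretches of obedience to a rule -/

/-- `followStake b w n` is `2 ^ n` times the capital, on the first `n` bits of `w`, of the sum over
`m` of the martingales which start with `2⁻ᵐ` and, from position `m` on, always bet everything on
the next bit being the one predicted by the rule `b`. -/
def followStake (b : List Bool → Bool) (w : List Bool) : ℕ → ℕ
  | 0 => 2
  | n + 1 => if w.getD n false = b (w.take n) then 4 * followStake b w n - 2 else 2

/-- The martingale which is the sum over `m` of those which start with `2⁻ᵐ` and, from position `m`
on, always bet everything on the prediction of the rule `b`. -/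
noncomputable def followMartingale (b : List Bool → Bool) (w : List Bool) : ℝ≥0 :=
  followStake b w w.length / 2 ^ w.length

lemma two_le_followStake (b : List Bool → Bool) (w : List Bool) (n : ℕ) :
    2 ≤ followStake b w n := by
  induction n with
  | zero => simp [followStake]
  | succ n ih =>
    rw [followStake]
    split_ifs <;> omega

lemma followStake_append (b : List Bool → Bool) (w v : List Bool) {n : ℕ} (hn : n ≤ w.length) :
    followStake b (w ++ v) n = followStake b w n := by
  induction n with
  | zero => rfl
  | succ n ih =>
    rw [followStake, followStake, ih (by omega), List.take_append_of_le_length (by omega),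
      List.getD_append _ _ _ _ (by omega)]

lemma followStake_concat (b : List Bool → Bool) (w : List Bool) (x : Bool) :
    followStake b (w ++ [x]) (w ++ [x]).length =
      if x = b w then 4 * followStake b w w.length - 2 else 2 := by
  rw [List.length_append, List.length_singleton, followStake, followStake_append _ _ _ le_rfl]
  simp

lemma isMartingale_followMartingale (b : List Bool → Bool) :
    IsMartingale (followMartingale b) := by
  intro w
  have h2 := two_le_followStake b w w.length
  have key : followStake b (w ++ [false]) (w ++ [false]).length +
      followStake b (w ++ [true]) (w ++ [true]).length = 4 * followStake b w w.length := by
    rw [followStake_concat, followStake_concat]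
    cases b w <;> simp <;> omega
  simp only [followMartingale]
  have hl : ∀ x : Bool, (w ++ [x]).length = w.length + 1 := by simp
  rw [hl] at key ⊢
  rw [hl] at key ⊢
  rw [← add_div, ← Nat.cast_add, key, pow_succ]
  push_cast
  field_simp
  ring

lemma computable_followStake {b : List Bool → Bool} (hb : Computable b) :
    Computable fun w : List Bool => followStake b w w.length := by
  have hg : Computable fun p : List Bool × ℕ × ℕ => p.1.getD p.2.1 false :=
    ((Primrec.list_getD false).comp Primrec.fst (Primrec.fst.comp Primrec.snd)).to_comp
  have ht : Computable fun p : List Bool × ℕ × ℕ => b (p.1.take p.2.1) :=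
    hb.comp (Primrec.list_take.comp (Primrec.fst.comp Primrec.snd) Primrec.fst).to_comp
  have hc : Computable fun p : List Bool × ℕ × ℕ =>
      decide (p.1.getD p.2.1 false = b (p.1.take p.2.1)) :=
    (Primrec.eq (α := Bool)).decide.to_comp.comp hg ht
  have hN : Computable fun p : List Bool × ℕ × ℕ => 4 * p.2.2 - 2 :=
    (Primrec.nat_sub.comp (Primrec.nat_mul.comp (Primrec.const 4)
      (Primrec.snd.comp Primrec.snd)) (Primrec.const 2)).to_comp
  refine (Computable.nat_rec (h := fun w (q : ℕ × ℕ) =>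
      bif decide (w.getD q.1 false = b (w.take q.1)) then 4 * q.2 - 2 else 2)
    Computable.list_length (Computable.const 2)
    (Computable.cond hc hN (Computable.const 2)).to₂).of_eq fun w => ?_
  generalize w.length = n
  induction n with
  | zero => rfl
  | succ n ih => simp [followStake, ← ih]

lemma isComputableFun_followMartingale {b : List Bool → Bool} (hb : Computable b) :
    IsComputableFun (followMartingale b) := by
  refine ⟨fun w n => followStake b w w.length * 2 ^ n / 2 ^ w.length, ?_, fun w n => ?_⟩
  · exact Primrec.nat_div.to_comp.comp
      (Primrec.nat_mul.to_comp.comp ((computable_followStake hb).comp Computable.fst)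
        (primrec_two_pow.to_comp.comp Computable.snd))
      (primrec_two_pow.to_comp.comp (Computable.list_length.comp Computable.fst))
  · set N := followStake b w w.length * 2 ^ n
    have e1 : ((N / 2 ^ w.length : ℕ) : ℝ) * 2 ^ w.length ≤ N := by
      exact_mod_cast Nat.div_mul_le_self N (2 ^ w.length)
    have e2 : (N : ℝ) < ((N / 2 ^ w.length : ℕ) : ℝ) * 2 ^ w.length + 2 ^ w.length := by
      exact_mod_cast Nat.lt_div_mul_add (a := N) (b := 2 ^ w.length) (by positivity)
    have hval : (followMartingale b w : ℝ) = N / 2 ^ w.length / 2 ^ n := by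
      simp only [followMartingale, N]
      push_cast
      field_simp
    have hn : (0 : ℝ) < 2 ^ n := by positivity
    have hl : (0 : ℝ) < 2 ^ w.length := by positivity
    rw [hval, ← sub_div, abs_div, abs_of_pos hn]
    gcongr
    rw [abs_le]
    constructor
    · have : (N : ℝ) / 2 ^ w.length ≤ ((N / 2 ^ w.length : ℕ) : ℝ) + 1 := by
        rw [div_le_iff₀ hl]; linarith
      linarith
    · have : ((N / 2 ^ w.length : ℕ) : ℝ) ≤ N / 2 ^ w.length := (le_div_iff₀ hl).2 e1
      linarith

lemma mem_successSet_followMartingale {b : List Bool → Bool} {A : Cantor}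
    (h : ∀ j : ℕ, ∃ n, j ≤ n ∧ ∀ i, n ≤ i → i < 3 * n → A i = b (A.restr i)) :
    A ∈ successSet (followMartingale b) := by
  rw [mem_successSet_iff]
  intro k
  obtain ⟨n, hkn, hn⟩ := h k
  refine ⟨3 * n, ?_⟩
  have hgrow : ∀ i, i ≤ 2 * n →
      4 ^ i + 1 ≤ followStake b (A.restr (n + i)) (A.restr (n + i)).length := by
    intro i hi
    induction i with
    | zero => simpa using two_le_followStake b (A.restr n) _
    | succ i ih =>
      have := ih (by omega)
      rw [← add_assoc, Cantor.restr_succ, followStake_concat, if_pos (hn _ (by omega) (by omega)),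
        pow_succ]
      omega
  have h3 := hgrow (2 * n) le_rfl
  rw [show n + 2 * n = 3 * n by ring] at h3
  rw [followMartingale, lt_div_iff₀ (by positivity), Cantor.length_restr]
  rw [Cantor.length_restr] at h3
  have hlt : k * 2 ^ (3 * n) < followStake b (A.restr (3 * n)) (3 * n) := by
    calc k * 2 ^ (3 * n) ≤ 2 ^ n * 2 ^ (3 * n) := by
          gcongr; exact hkn.trans Nat.lt_two_pow_self.le
      _ = 4 ^ (2 * n) := by rw [← pow_add, show 4 = 2 ^ 2 by rfl, ← pow_mul]; congr 1; ring
      _ < _ := by omega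
  exact_mod_cast hlt

/-! ### Closed classes on which a martingale stays small -/

/-- The value of `D` on `s` leaves enough room below the bound `8` to follow from `s` on a rule
which lets `D` grow by at most `2 / 2 ^ n` at each length `n`: the sum of these increments from
`s` on is `4 / 2 ^ s.length`, and the larger reserve makes the bound strict after one step. -/
def HasRoom (D : List Bool → ℝ≥0) (s : List Bool) : Prop :=
  (D s : ℝ) + 8 / 2 ^ s.length ≤ 8

/-- The closed class of all sequences which extend `s` and along which, from `s` on, `D` leaves
room below `8`. -/
def roomClass (D : List Bool → ℝ≥0) (s : List Bool) : Set Cantor :=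
  {A | A.restr s.length = s ∧ ∀ n, s.length ≤ n → HasRoom D (A.restr n)}

lemma isClosed_roomClass (D : List Bool → ℝ≥0) (s : List Bool) : IsClosed (roomClass D s) := by
  have h : roomClass D s = {A | A.restr s.length = s} ∩
      ⋂ (n) (_ : s.length ≤ n), {A : Cantor | HasRoom D (A.restr n)} := by
    ext A
    simp [roomClass]
  rw [h]
  exact (Cantor.isClosed_restr_mem (· = s) s.length).inter
    (isClosed_iInter fun n => isClosed_iInter fun _ => Cantor.isClosed_restr_mem (HasRoom D) n)

lemma roomClass_restr_subset {D : List Bool → ℝ≥0} {s : List Bool} {A : Cantor}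
    (hA : A ∈ roomClass D s) {n : ℕ} (hn : s.length ≤ n) :
    roomClass D (A.restr n) ⊆ roomClass D s := by
  rintro B ⟨hB1, hB2⟩
  rw [Cantor.length_restr] at hB1 hB2
  refine ⟨(Cantor.restr_eq_of_le hn hB1).trans hA.1, fun m hm => ?_⟩
  rcases le_total n m with h | h
  · exact hB2 m h
  · rw [Cantor.restr_eq_of_le h hB1]
    exact hA.2 m hm

/-- One step along a good rule from a string with room gains strict inequality. -/
lemma HasRoom.concat_lt {D : List Bool → ℝ≥0} {b : List Bool → Bool} {s : List Bool}
    (hb : ∀ w, (D (w ++ [b w]) : ℝ) ≤ D w + 2 / 2 ^ w.length) (h : HasRoom D s) :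
    (D (s ++ [b s]) : ℝ) + 8 / 2 ^ (s ++ [b s]).length < 8 := by
  have h1 := hb s
  have h2 : (0 : ℝ) < 1 / 2 ^ s.length := by positivity
  have e1 : (8 : ℝ) / 2 ^ (s ++ [b s]).length = 4 * (1 / 2 ^ s.length) := by
    rw [List.length_append, List.length_singleton, pow_succ]
    field_simp
    norm_num
  rw [HasRoom, show (8 : ℝ) / 2 ^ s.length = 8 * (1 / 2 ^ s.length) by ring] at h
  rw [show (2 : ℝ) / 2 ^ s.length = 2 * (1 / 2 ^ s.length) by ring] at h1
  rw [e1]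
  linarith

lemma exists_mem_roomClass_following {D : List Bool → ℝ≥0} {b : List Bool → Bool}
    (hb : ∀ w, (D (w ++ [b w]) : ℝ) ≤ D w + 2 / 2 ^ w.length) {s : List Bool}
    (h : HasRoom D s) :
    ∃ A ∈ roomClass D s, ∀ n, s.length ≤ n → A n = b (A.restr n) := by
  obtain ⟨A, hA1, hA2⟩ := Cantor.exists_restr_eq_and_apply_eq s b
  refine ⟨A, ⟨hA1, fun n hn => ?_⟩, hA2⟩
  induction n, hn using Nat.le_induction with
  | base => rwa [hA1]
  | succ n hn ih =>
    rw [Cantor.restr_succ, hA2 n hn]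
    exact (HasRoom.concat_lt hb ih).le

/-- By Baire category inside `roomClass D s`: a `Gδ` class of computably random sequences cannot be
dense there, since a generic sequence obeys a computable rule on long stretches infinitely often. -/
lemma exists_roomClass_disjoint {D : List Bool → ℝ≥0} (hD : IsMartingale D)
    (hc : IsComputableFun D) {U : ℕ → Set Cantor} (hU : ∀ i, IsOpen (U i))
    (hsub : ⋂ i, U i ⊆ RANDcomp) {s : List Bool} (hs : HasRoom D s) :
    ∃ s', HasRoom D s' ∧ roomClass D s' ⊆ roomClass D s ∧
      roomClass D s' ⊆ (⋂ i, U i)ᶜ := by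
  obtain ⟨b, hbc, hb⟩ := exists_computable_rule hD hc
  by_contra! hcon
  let K : {s' // HasRoom D s' ∧ roomClass D s' ⊆ roomClass D s} → Set Cantor :=
    fun p => roomClass D p.1
  obtain ⟨A, -, hAW⟩ := exists_mem_of_forall_refine K
    (fun p => (exists_mem_roomClass_following hb p.2.1).imp fun _ h => h.1)
    (fun p => isClosed_roomClass D p.1) (fun p => (isClosed_roomClass D p.1).isCompact)
    (fun j => U j ∩ {A | ∃ n, j ≤ n ∧ ∀ i, n ≤ i → i < 3 * n → A i = b (A.restr i)})
    (fun j p => by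
      obtain ⟨t, ht, hts⟩ := p
      obtain ⟨A, hAt, hAU⟩ := Set.not_subset.1 (hcon t ht hts)
      obtain ⟨N, hN⟩ := Cantor.exists_restr_eq_subset (hU j)
        (Set.mem_iInter.1 (not_not.1 hAU) j)
      -- First pass to a basic open subclass of `U j`, then follow the rule for a long stretch.
      obtain ⟨n, hNn, htn, hjn⟩ : ∃ n, N ≤ n ∧ t.length ≤ n ∧ j ≤ n :=
        ⟨N + t.length + j, by omega, by omega, by omega⟩
      have hsub1 := roomClass_restr_subset hAt htn
      obtain ⟨B, hB, hBb⟩ := exists_mem_roomClass_following hb (hAt.2 n htn)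
      have hlen := Cantor.length_restr A n
      rw [hlen] at hBb
      have hn3 : (A.restr n).length ≤ 3 * n := by omega
      have hsub2 := roomClass_restr_subset hB hn3
      refine ⟨⟨B.restr (3 * n), hB.2 _ hn3, hsub2.trans (hsub1.trans hts)⟩,
        hsub2.trans hsub1, fun C hC => ⟨hN C ?_, n, hjn, fun i hni hi => ?_⟩⟩
      · have h1 := (hsub2 hC).1
        rw [hlen] at h1
        exact Cantor.restr_eq_of_le hNn h1
      · have h1 : C.restr (3 * n) = B.restr (3 * n) := by simpa using hC.1
        rw [Cantor.restr_eq_restr_iff.1 h1 i hi, Cantor.restr_eq_of_le hi.le h1]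
        exact hBb i hni)
    ⟨s, hs, subset_rfl⟩
  exact hsub (Set.mem_iInter.2 fun j => (hAW j).1) _ (isMartingale_followMartingale b)
    (isComputableFun_followMartingale hbc) (mem_successSet_followMartingale fun j => (hAW j).2)

/-- A further computable martingale can be kept bounded by adding a small multiple of it. -/
lemma exists_roomClass_bounded {D d : List Bool → ℝ≥0} (hD : IsMartingale D)
    (hDc : IsComputableFun D) (hd : IsMartingale d) (hdc : IsComputableFun d) {s : List Bool}
    (hs : HasRoom D s) :
    ∃ D' s', IsMartingale D' ∧ IsComputableFun D' ∧ HasRoom D' s' ∧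
      roomClass D' s' ⊆ roomClass D s ∧ roomClass D' s' ⊆ (successSet d)ᶜ := by
  obtain ⟨b, -, hb⟩ := exists_computable_rule hD hDc
  set t := s ++ [b s] with ht
  have hlt : (D t : ℝ) + 8 / 2 ^ t.length < 8 := hs.concat_lt hb
  obtain ⟨k, hk⟩ : ∃ k : ℕ, (d t : ℝ) / 2 ^ k < 8 - (D t + 8 / 2 ^ t.length) := by
    obtain ⟨k, hk⟩ := pow_unbounded_of_one_lt
      ((d t : ℝ) / (8 - (D t + 8 / 2 ^ t.length))) (one_lt_two (α := ℝ))
    refine ⟨k, ?_⟩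
    rw [div_lt_iff₀ (by linarith)] at hk
    rw [div_lt_iff₀ (by positivity)]
    linarith
  have hroom : ∀ w, HasRoom (fun w => D w + d w / 2 ^ k) w → HasRoom D w ∧ d w ≤ 8 * 2 ^ k := by
    intro w hw
    simp only [HasRoom, NNReal.coe_add, NNReal.coe_div, NNReal.coe_pow, NNReal.coe_ofNat] at hw ⊢
    have h1 : (0 : ℝ) ≤ d w / 2 ^ k := by positivity
    have h2 : (0 : ℝ) ≤ 8 / 2 ^ w.length := by positivity
    have h3 : (0 : ℝ) ≤ D w := (D w).2
    refine ⟨by linarith, ?_⟩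
    have h4 : (d w : ℝ) ≤ 8 * 2 ^ k := (div_le_iff₀ (by positivity)).1 (by linarith)
    exact_mod_cast h4
  refine ⟨fun w => D w + d w / 2 ^ k, t, hD.add_div hd _, hDc.add_div_two_pow hdc k, ?_, ?_, ?_⟩
  · simp only [HasRoom, NNReal.coe_add, NNReal.coe_div, NNReal.coe_pow, NNReal.coe_ofNat]
    linarith
  · rintro A ⟨hA1, hA2⟩
    have hl : t.length = s.length + 1 := by simp [ht]
    have hAs : A.restr s.length = s := by
      rw [hl, Cantor.restr_succ, ht] at hA1
      exact List.append_inj_left' hA1 rfl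
    refine ⟨hAs, fun n hn => ?_⟩
    rcases hn.eq_or_lt with rfl | h
    · rwa [hAs]
    · exact (hroom _ (hA2 n (by omega))).1
  · rintro A ⟨-, hA2⟩ hA
    have hle : Filter.limsup (fun n : ℕ => (d (A.restr n) : ℝ≥0∞)) Filter.atTop
        ≤ ((8 * 2 ^ k : ℝ≥0) : ℝ≥0∞) :=
      Filter.limsup_le_of_le (h := Filter.eventually_atTop.2
        ⟨t.length, fun n hn => ENNReal.coe_le_coe.2 (hroom _ (hA2 n hn)).2⟩)
    rw [show Filter.limsup (fun n : ℕ => (d (A.restr n) : ℝ≥0∞)) Filter.atTop = ⊤ from hA] at hle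
    exact absurd hle (not_le.2 ENNReal.coe_lt_top)

/-! ### Codes of computable martingales -/

open Nat.Partrec (Code)
open Encodable (encode decode)

/-- The program `e` computes dyadic approximations to `d`. -/
def CodesFun (e : Code) (d : List Bool → ℝ≥0) : Prop :=
  ∀ (w : List Bool) (n : ℕ), ∃ v ∈ e.eval (encode (w, n)),
    |(v : ℝ) / 2 ^ n - (d w : ℝ)| ≤ 1 / 2 ^ n

lemma IsComputableFun.exists_codesFun {d : List Bool → ℝ≥0} (hd : IsComputableFun d) :
    ∃ e, CodesFun e d := by
  obtain ⟨f, hf, hfd⟩ := hd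
  obtain ⟨e, he⟩ := Code.exists_code.1 (show Nat.Partrec _ from hf)
  refine ⟨e, fun w n => ⟨f w n, ?_, hfd w n⟩⟩
  rw [he]
  simp

lemma CodesFun.isComputableFun {e : Code} {d : List Bool → ℝ≥0} (h : CodesFun e d) :
    IsComputableFun d := by
  choose f hf hfd using h
  refine ⟨f, ?_, hfd⟩
  have : Partrec fun p : List Bool × ℕ => e.eval (encode p) :=
    Code.eval_part.comp (Computable.const e) Computable.encode
  exact this.of_eq fun p => Part.eq_some_iff.2 (hf p.1 p.2)

lemma eq_of_forall_abs_sub_le {x y : ℝ} (h : ∀ n : ℕ, |x - y| ≤ 2 / 2 ^ n) : x = y := by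
  have ht : Filter.Tendsto (fun n : ℕ => (2 : ℝ) / 2 ^ n) Filter.atTop (nhds 0) :=
    (tendsto_pow_atTop_atTop_of_one_lt one_lt_two).const_div_atTop 2
  have : |x - y| ≤ 0 := ge_of_tendsto' ht h
  exact sub_eq_zero.1 (abs_nonpos_iff.1 this)

lemma CodesFun.unique {e : Code} {d d' : List Bool → ℝ≥0} (h : CodesFun e d)
    (h' : CodesFun e d') : d = d' := by
  funext w
  refine NNReal.coe_injective (eq_of_forall_abs_sub_le fun n => ?_)
  obtain ⟨v, hv, hd⟩ := h w n
  obtain ⟨v', hv', hd'⟩ := h' w n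
  obtain rfl := Part.mem_unique hv hv'
  calc |(d w : ℝ) - d' w| ≤ |(d w : ℝ) - v / 2 ^ n| + |(v : ℝ) / 2 ^ n - d' w| := abs_sub_le _ _ _
    _ ≤ 1 / 2 ^ n + 1 / 2 ^ n := by rw [abs_sub_comm]; gcongr
    _ = 2 / 2 ^ n := by ring

lemma countable_computable_martingales :
    {d | IsMartingale d ∧ IsComputableFun d}.Countable := by
  choose c hc using fun d : {d | IsMartingale d ∧ IsComputableFun d} => d.2.2.exists_codesFun
  exact Function.Injective.countable (f := c) fun d d' h =>
    Subtype.ext ((hc d).unique (h ▸ hc d'))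

/-- The `t`-step result of the program `e` on the string `w` and the precision `n`. -/
def approxIn (t : ℕ) (e : Code) (w : List Bool) (n : ℕ) : Option ℕ :=
  e.evaln t (encode (w, n))

lemma approxIn_mono {t t' : ℕ} (h : t ≤ t') {e : Code} {w : List Bool} {n v : ℕ}
    (hv : approxIn t e w n = some v) : approxIn t' e w n = some v :=
  Code.evaln_mono h hv

/-- Within `t` steps the program `e` is seen to satisfy the constraint with parameters `w, m, n`
on programs which compute a martingale: its approximations on `w` at the precisions `m` and `n`
are compatible, and those at precision `n` satisfy the martingale equality up to the rounding
errors. -/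
def CheckedAt (t : ℕ) (e : Code) (w : List Bool) (m n : ℕ) : Prop :=
  ((approxIn t e w m).isSome ∧ (approxIn t e w n).isSome ∧
    (approxIn t e (w ++ [false]) n).isSome ∧ (approxIn t e (w ++ [true]) n).isSome) ∧
  (approxIn t e w m).getD 0 * 2 ^ n ≤ (approxIn t e w n).getD 0 * 2 ^ m + (2 ^ m + 2 ^ n) ∧
  (approxIn t e w n).getD 0 * 2 ^ m ≤ (approxIn t e w m).getD 0 * 2 ^ n + (2 ^ m + 2 ^ n) ∧
  2 * (approxIn t e w n).getD 0 ≤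
    (approxIn t e (w ++ [false]) n).getD 0 + (approxIn t e (w ++ [true]) n).getD 0 + 4 ∧
  (approxIn t e (w ++ [false]) n).getD 0 + (approxIn t e (w ++ [true]) n).getD 0 ≤
    2 * (approxIn t e w n).getD 0 + 4

/-- Every program that passes all checks computes a martingale. -/
lemma exists_codesFun_of_forall_checkedAt {e : Code}
    (h : ∀ w m n, ∃ t, CheckedAt t e w m n) : ∃ d, IsMartingale d ∧ CodesFun e d := by
  have hv : ∀ (w : List Bool) (n : ℕ), ∃ v, v ∈ e.eval (encode (w, n)) := by
    intro w n
    obtain ⟨t, ⟨h1, -⟩, -⟩ := h w n n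
    obtain ⟨v, hv⟩ := Option.isSome_iff_exists.1 h1
    exact ⟨v, Code.evaln_sound hv⟩
  choose f hf using hv
  have hget : ∀ {t w n}, (approxIn t e w n).isSome → (approxIn t e w n).getD 0 = f w n := by
    intro t w n hs
    obtain ⟨v, hv⟩ := Option.isSome_iff_exists.1 hs
    rw [hv]
    exact Part.mem_unique (Code.evaln_sound hv) (hf w n)
  have hcheck : ∀ w m n, f w m * 2 ^ n ≤ f w n * 2 ^ m + (2 ^ m + 2 ^ n) ∧
      2 * f w n ≤ f (w ++ [false]) n + f (w ++ [true]) n + 4 ∧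
      f (w ++ [false]) n + f (w ++ [true]) n ≤ 2 * f w n + 4 := by
    intro w m n
    obtain ⟨t, ⟨h1, h2, h3, h4⟩, h5, -, h6, h7⟩ := h w m n
    rw [hget h1, hget h2] at h5
    rw [hget h2, hget h3, hget h4] at h6 h7
    exact ⟨h5, h6, h7⟩
  have hp : ∀ n : ℕ, (0 : ℝ) < 2 ^ n := fun n => by positivity
  have ht0 : ∀ c : ℝ, Filter.Tendsto (fun n : ℕ => c / 2 ^ n) Filter.atTop (nhds 0) :=
    fun c => (tendsto_pow_atTop_atTop_of_one_lt one_lt_two).const_div_atTop c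
  have hcompat : ∀ w m n, (f w m : ℝ) / 2 ^ m ≤ f w n / 2 ^ n + (1 / 2 ^ m + 1 / 2 ^ n) := by
    intro w m n
    have h1 : (f w m : ℝ) * 2 ^ n ≤ f w n * 2 ^ m + (2 ^ m + 2 ^ n) := by
      exact_mod_cast (hcheck w m n).1
    have h2 := hp m
    have h3 := hp n
    rw [show (f w n : ℝ) / 2 ^ n + (1 / 2 ^ m + 1 / 2 ^ n) =
      (f w n * 2 ^ m + (2 ^ m + 2 ^ n)) / 2 ^ n / 2 ^ m by field_simp; ring]
    gcongr
    rwa [le_div_iff₀ h3]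
  have habs : ∀ w m n, |(f w m : ℝ) / 2 ^ m - f w n / 2 ^ n| ≤ 1 / 2 ^ m + 1 / 2 ^ n := by
    intro w m n
    have h1 := hcompat w m n
    have h2 := hcompat w n m
    rw [abs_le]
    constructor <;> linarith
  have hlim : ∀ w, ∃ x : ℝ≥0, Filter.Tendsto (fun n => (f w n : ℝ) / 2 ^ n) Filter.atTop
      (nhds (x : ℝ)) := by
    intro w
    have hcau : CauchySeq fun n => (f w n : ℝ) / 2 ^ n := by
      refine cauchySeq_of_le_tendsto_0 (fun n => 2 / 2 ^ n) (fun n m N hn hm => ?_) (ht0 2)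
      rw [Real.dist_eq]
      have hmono : ∀ k, N ≤ k → (1 : ℝ) / 2 ^ k ≤ 1 / 2 ^ N := fun k hk => by
        gcongr
        norm_num
      have := habs w n m
      have := hmono n hn
      have := hmono m hm
      have e2 : (2 : ℝ) / 2 ^ N = 1 / 2 ^ N + 1 / 2 ^ N := by ring
      linarith
    obtain ⟨x, hx⟩ := cauchySeq_tendsto_of_complete hcau
    have hx0 : 0 ≤ x := ge_of_tendsto' hx fun n => by positivity
    exact ⟨⟨x, hx0⟩, hx⟩
  choose d hd using hlim
  refine ⟨d, fun w => NNReal.coe_injective ?_, fun w n => ⟨f w n, hf w n, ?_⟩⟩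
  · push_cast
    have hl := (((hd w).const_mul 2).sub ((hd (w ++ [false])).add (hd (w ++ [true])))).abs
    have hb : ∀ n, |2 * ((f w n : ℝ) / 2 ^ n) - ((f (w ++ [false]) n : ℝ) / 2 ^ n +
        (f (w ++ [true]) n : ℝ) / 2 ^ n)| ≤ 4 / 2 ^ n := by
      intro n
      have h1 : 2 * (f w n : ℝ) ≤ f (w ++ [false]) n + f (w ++ [true]) n + 4 := by
        exact_mod_cast (hcheck w n n).2.1
      have h2 : (f (w ++ [false]) n : ℝ) + f (w ++ [true]) n ≤ 2 * f w n + 4 := by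
        exact_mod_cast (hcheck w n n).2.2
      rw [← add_div, mul_div_assoc', ← sub_div, abs_div, abs_of_pos (hp n)]
      gcongr
      rw [abs_le]
      constructor <;> linarith
    have := le_of_tendsto_of_tendsto' hl (ht0 4) hb
    exact sub_eq_zero.1 (abs_nonpos_iff.1 this)
  · have hl := ((hd w).const_sub ((f w n : ℝ) / 2 ^ n)).abs
    have hr : Filter.Tendsto (fun m : ℕ => (1 : ℝ) / 2 ^ n + 1 / 2 ^ m) Filter.atTop
        (nhds (1 / 2 ^ n)) := by
      have := (ht0 1).const_add (1 / 2 ^ n)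
      rwa [add_zero] at this
    exact le_of_tendsto_of_tendsto' hl hr fun m => habs w n m

lemma CodesFun.exists_checkedAt {e : Code} {d : List Bool → ℝ≥0} (hd : IsMartingale d)
    (h : CodesFun e d) (w : List Bool) (m n : ℕ) : ∃ t, CheckedAt t e w m n := by
  have hex : ∀ w n, ∃ v t, approxIn t e w n = some v ∧
      |(v : ℝ) / 2 ^ n - (d w : ℝ)| ≤ 1 / 2 ^ n := by
    intro w n
    obtain ⟨v, hv, hvd⟩ := h w n
    obtain ⟨t, ht⟩ := Code.evaln_complete.1 hv
    exact ⟨v, t, ht, hvd⟩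
  obtain ⟨v1, t1, h1, e1⟩ := hex w m
  obtain ⟨v2, t2, h2, e2⟩ := hex w n
  obtain ⟨v3, t3, h3, e3⟩ := hex (w ++ [false]) n
  obtain ⟨v4, t4, h4, e4⟩ := hex (w ++ [true]) n
  have hm : (0 : ℝ) < 2 ^ m := by positivity
  have hn : (0 : ℝ) < 2 ^ n := by positivity
  -- Clear denominators in the error estimates.
  have hclear : ∀ {v k : ℕ} {x : ℝ}, |(v : ℝ) / 2 ^ k - x| ≤ 1 / 2 ^ k →
      v ≤ x * 2 ^ k + 1 ∧ x * 2 ^ k ≤ v + 1 := by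
    intro v k x hx
    have hk : (0 : ℝ) < 2 ^ k := by positivity
    obtain ⟨ha, hb⟩ := abs_le.1 hx
    have ha' := mul_le_mul_of_nonneg_right ha hk.le
    have hb' := mul_le_mul_of_nonneg_right hb hk.le
    rw [sub_mul, div_mul_cancel₀ _ hk.ne'] at ha' hb'
    rw [neg_mul, div_mul_cancel₀ _ hk.ne'] at ha'
    rw [div_mul_cancel₀ _ hk.ne'] at hb'
    constructor <;> linarith
  have hmart : 2 * (d w : ℝ) = d (w ++ [false]) + d (w ++ [true]) := by exact_mod_cast hd w
  have hmart' : 2 * ((d w : ℝ) * 2 ^ n) =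
      d (w ++ [false]) * 2 ^ n + d (w ++ [true]) * 2 ^ n := by
    rw [← mul_assoc, hmart]; ring
  obtain ⟨a1, b1⟩ := hclear e1
  obtain ⟨a2, b2⟩ := hclear e2
  obtain ⟨a3, b3⟩ := hclear e3
  obtain ⟨a4, b4⟩ := hclear e4
  have a1' := mul_le_mul_of_nonneg_right a1 hn.le
  have b1' := mul_le_mul_of_nonneg_right b1 hn.le
  have a2' := mul_le_mul_of_nonneg_right a2 hm.le
  have b2' := mul_le_mul_of_nonneg_right b2 hm.le
  refine ⟨t1 + t2 + t3 + t4, ?_⟩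
  rw [CheckedAt, approxIn_mono (by omega) h1, approxIn_mono (by omega) h2,
    approxIn_mono (by omega) h3, approxIn_mono (by omega) h4]
  simp only [Option.isSome_some, Option.getD_some, and_self, true_and]
  refine ⟨?_, ?_, ?_, ?_⟩
  · have : (v1 : ℝ) * 2 ^ n ≤ v2 * 2 ^ m + (2 ^ m + 2 ^ n) := by linarith
    exact_mod_cast this
  · have : (v2 : ℝ) * 2 ^ m ≤ v1 * 2 ^ n + (2 ^ m + 2 ^ n) := by linarith
    exact_mod_cast this
  · have : 2 * (v2 : ℝ) ≤ v3 + v4 + 4 := by linarith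
    exact_mod_cast this
  · have : (v3 : ℝ) + v4 ≤ 2 * v2 + 4 := by linarith
    exact_mod_cast this

lemma CodesFun.mem_successSet_iff {e : Code} {d : List Bool → ℝ≥0} (h : CodesFun e d)
    {A : Cantor} : A ∈ successSet d ↔
      ∀ k : ℕ, ∃ n t, k < (approxIn t e (A.restr n) 0).getD 0 := by
  rw [_root_.mem_successSet_iff]
  have hval : ∀ w, ∃ v : ℕ, v ∈ e.eval (encode (w, 0)) ∧
      (v : ℝ) ≤ d w + 1 ∧ (d w : ℝ) ≤ v + 1 := by
    intro w
    obtain ⟨v, hv, hvd⟩ := h w 0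
    simp only [pow_zero, div_one] at hvd
    obtain ⟨h1, h2⟩ := abs_le.1 hvd
    exact ⟨v, hv, by linarith, by linarith⟩
  constructor
  · intro hA k
    obtain ⟨n, hn⟩ := hA (k + 1)
    obtain ⟨v, hv, -, h2⟩ := hval (A.restr n)
    obtain ⟨t, ht⟩ := Code.evaln_complete.1 hv
    refine ⟨n, t, ?_⟩
    have hn' : ((k : ℝ) + 1) < d (A.restr n) := by exact_mod_cast hn
    have : (k : ℝ) < v := by linarith
    rw [show approxIn t e (A.restr n) 0 = some v from ht]
    exact_mod_cast this
  · intro hA k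
    obtain ⟨n, t, hnt⟩ := hA (k + 1)
    refine ⟨n, ?_⟩
    obtain ⟨v, hv, h1, -⟩ := hval (A.restr n)
    cases hs : approxIn t e (A.restr n) 0 with
    | none => simp [hs] at hnt
    | some u =>
      rw [hs, Option.getD_some] at hnt
      obtain rfl := Part.mem_unique (Code.evaln_sound hs) hv
      have hk : (k : ℝ) + 1 < u := by exact_mod_cast hnt
      have : (k : ℝ) < d (A.restr n) := by linarith
      exact_mod_cast this

/-! ### The arithmetical description of computable randomness -/

lemma primrec_approxIn {α : Type*} [Primcodable α] {t : α → ℕ} {e : α → Code}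
    {w : α → List Bool} {n : α → ℕ} (ht : Primrec t) (he : Primrec e) (hw : Primrec w)
    (hn : Primrec n) : Primrec fun a => approxIn (t a) (e a) (w a) (n a) :=
  Code.primrec_evaln.comp ((ht.pair he).pair (Primrec.encode.comp (hw.pair hn)))

lemma primrecPred_checkedAt {α : Type*} [Primcodable α] {t : α → ℕ} {e : α → Code}
    {w : α → List Bool} {m n : α → ℕ} (ht : Primrec t) (he : Primrec e) (hw : Primrec w)
    (hm : Primrec m) (hn : Primrec n) :
    PrimrecPred fun a => CheckedAt (t a) (e a) (w a) (m a) (n a) := by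
  have hx : ∀ x : Bool, Primrec fun a => w a ++ [x] := fun x =>
    Primrec.list_concat.comp hw (Primrec.const x)
  have h1 := primrec_approxIn ht he hw hm
  have h2 := primrec_approxIn ht he hw hn
  have h3 := primrec_approxIn ht he (hx false) hn
  have h4 := primrec_approxIn ht he (hx true) hn
  have hs : ∀ {o : α → Option ℕ}, Primrec o → PrimrecPred fun a => (o a).isSome = true :=
    fun ho => Primrec.eq.comp (Primrec.option_isSome.comp ho) (Primrec.const true)
  have hg : ∀ {o : α → Option ℕ}, Primrec o → Primrec fun a => (o a).getD 0 :=
    fun ho => Primrec.option_getD.comp ho (Primrec.const 0)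
  have hm2 := primrec_two_pow.comp hm
  have hn2 := primrec_two_pow.comp hn
  have hadd := Primrec.nat_add.comp hm2 hn2
  have hsum := Primrec.nat_add.comp (hg h3) (hg h4)
  have hdbl := Primrec.nat_mul.comp (Primrec.const 2) (hg h2)
  exact ((hs h1).and ((hs h2).and ((hs h3).and (hs h4)))).and
    ((Primrec.nat_le.comp (Primrec.nat_mul.comp (hg h1) hn2)
      (Primrec.nat_add.comp (Primrec.nat_mul.comp (hg h2) hm2) hadd)).and
    ((Primrec.nat_le.comp (Primrec.nat_mul.comp (hg h2) hm2)
      (Primrec.nat_add.comp (Primrec.nat_mul.comp (hg h1) hn2) hadd)).and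
    ((Primrec.nat_le.comp hdbl (Primrec.nat_add.comp hsum (Primrec.const 4))).and
      (Primrec.nat_le.comp hsum (Primrec.nat_add.comp hdbl (Primrec.const 4))))))

/-- The parameters of the check with number `j`. -/
def checkParam (j : ℕ) : List Bool × ℕ × ℕ :=
  (decode (α := List Bool × ℕ × ℕ) j).getD ([], 0, 0)

/-- The matrix of the description of computable randomness. The number `k` is either a claim that
the program number `i` fails check `k.unpair.2`, or a bound on the values of the program. In the
latter case the length of `w` encodes both a number of steps and the length of the initial segment
of `w` on which the program is run. -/
def randMatrix (i k : ℕ) (w : List Bool) : Prop :=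
  (k.unpair.1 = 0 ∧ ¬ CheckedAt w.length (Denumerable.ofNat Code i) (checkParam k.unpair.2).1
      (checkParam k.unpair.2).2.1 (checkParam k.unpair.2).2.2) ∨
  (¬ k.unpair.1 = 0 ∧ (approxIn w.length.unpair.1 (Denumerable.ofNat Code i)
      (w.take w.length.unpair.2) 0).getD 0 ≤ k.unpair.2)

lemma computablePred_randMatrix : ComputablePred fun p : List ℕ × List Bool =>
    randMatrix (p.1.getD 0 0) (p.1.getD 1 0) p.2 := by
  have hget : ∀ i, Primrec fun p : List ℕ × List Bool => p.1.getD i 0 := fun i =>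
    (Primrec.list_getD 0).comp Primrec.fst (Primrec.const i)
  have he : Primrec fun p : List ℕ × List Bool => Denumerable.ofNat Code (p.1.getD 0 0) :=
    (Primrec.ofNat Code).comp (hget 0)
  have hk := Primrec.unpair.comp (hget 1)
  have hk1 := Primrec.fst.comp hk
  have hk2 := Primrec.snd.comp hk
  have hpar : Primrec fun p : List ℕ × List Bool => checkParam ((p.1.getD 1 0).unpair.2) :=
    Primrec.option_getD.comp (Primrec.decode.comp hk2) (Primrec.const _)
  have hl : Primrec fun p : List ℕ × List Bool => p.2.length :=
    Primrec.list_length.comp Primrec.snd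
  have hl' := Primrec.unpair.comp hl
  have hz : PrimrecPred fun p : List ℕ × List Bool => (p.1.getD 1 0).unpair.1 = 0 :=
    Primrec.eq.comp hk1 (Primrec.const 0)
  have hchk := primrecPred_checkedAt hl he (Primrec.fst.comp hpar)
    (Primrec.fst.comp (Primrec.snd.comp hpar)) (Primrec.snd.comp (Primrec.snd.comp hpar))
  have hval := primrec_approxIn (Primrec.fst.comp hl') he
    (Primrec.list_take.comp (Primrec.snd.comp hl') Primrec.snd) (Primrec.const 0)
  have hle := Primrec.nat_le.comp (Primrec.option_getD.comp hval (Primrec.const 0)) hk2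
  obtain ⟨_, h⟩ := (hz.and hchk.not).or (hz.not.and hle)
  exact ⟨_, h.to_comp⟩

/-- A sequence is computably random if and only if each program either fails some check, at every
number of steps, or has bounded values on its initial segments. -/
lemma mem_RANDcomp_iff {A : Cantor} :
    A ∈ RANDcomp ↔ ∀ i, ∃ k, ∀ n, randMatrix i k (A.restr n) := by
  constructor
  · intro hA i
    set e := Denumerable.ofNat Code i with he
    by_cases hv : ∀ w m n, ∃ t, CheckedAt t e w m n
    · obtain ⟨d, hd, hed⟩ := exists_codesFun_of_forall_checkedAt hv
      have hnot := hA d hd hed.isComputableFun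
      rw [hed.mem_successSet_iff] at hnot
      push Not at hnot
      obtain ⟨k, hk⟩ := hnot
      refine ⟨Nat.pair 1 k, fun n => Or.inr ⟨by simp, ?_⟩⟩
      rw [Cantor.take_restr, Nat.unpair_pair]
      exact hk _ _
    · push Not at hv
      obtain ⟨w, m, n, hw⟩ := hv
      refine ⟨Nat.pair 0 (encode (w, m, n)), fun l => Or.inl ⟨by simp, ?_⟩⟩
      simpa [checkParam] using hw l
  · intro h d hd hdc hs
    obtain ⟨e, hed⟩ := hdc.exists_codesFun
    obtain ⟨k, hk⟩ := h (encode e)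
    rcases Nat.eq_zero_or_pos k.unpair.1 with h0 | h0
    · obtain ⟨t, ht⟩ := hed.exists_checkedAt hd (checkParam k.unpair.2).1
        (checkParam k.unpair.2).2.1 (checkParam k.unpair.2).2.2
      rcases hk t with h1 | h1
      · simp [Denumerable.ofNat_encode] at h1
        exact h1.2 ht
      · exact h1.1 h0
    · obtain ⟨n, t, hnt⟩ := hed.mem_successSet_iff.1 hs k.unpair.2
      -- The length `l` below encodes the number of steps `t` and the length `n`, and `n ≤ l`.
      rcases hk (Nat.pair t n) with h1 | h1
      · exact h0.ne' h1.1
      · have h2 := h1.2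
        rw [Cantor.take_restr, Cantor.length_restr, Nat.unpair_pair,
          min_eq_left (Nat.right_le_pair t n), Denumerable.ofNat_encode] at h2
        exact absurd h2 (not_le.2 hnt)

lemma lightPi_three_RANDcomp : LightPi 3 RANDcomp := by
  refine ⟨fun ks w => randMatrix (ks.getD 0 0) (ks.getD 1 0) w, computablePred_randMatrix,
    fun A => ?_⟩
  rw [mem_RANDcomp_iff]
  simp [PiForm, SigmaForm]

/-! ### The Borel hierarchy -/

/-- Given `Gδ` classes `T i` of computably random sequences, fusion avoids all of them while keeping
all computable martingales bounded, so their union is not all of `RANDcomp`. -/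
lemma not_boldSigma_three_RANDcomp : ¬ BoldSigma 3 RANDcomp := by
  rintro ⟨T, hT, hRT⟩
  have hG : ∀ i, ∃ U : ℕ → Set Cantor, (∀ j, IsOpen (U j)) ∧ T i = ⋂ j, U j := by
    intro i
    obtain ⟨F, hF, hFT⟩ := hT i
    exact ⟨fun j => (F j)ᶜ, hF, by rw [← Set.compl_iUnion, ← hFT, compl_compl]⟩
  have hTR : ∀ i, T i ⊆ RANDcomp := fun i => hRT ▸ Set.subset_iUnion T i
  obtain ⟨dd, hdd⟩ := countable_computable_martingales.exists_eq_range
    ⟨_, isMartingale_zero, isComputableFun_zero⟩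
  have hdd' : ∀ i, IsMartingale (dd i) ∧ IsComputableFun (dd i) := fun i =>
    hdd.superset (Set.mem_range_self i)
  let X := {p : (List Bool → ℝ≥0) × List Bool //
    IsMartingale p.1 ∧ IsComputableFun p.1 ∧ HasRoom p.1 p.2}
  obtain ⟨A, -, hA⟩ := exists_mem_of_forall_refine (fun p : X => roomClass p.1.1 p.1.2)
    (fun ⟨p, h1, h2, h3⟩ => by
      obtain ⟨b, -, hb⟩ := exists_computable_rule h1 h2
      exact (exists_mem_roomClass_following hb h3).imp fun _ h => h.1)
    (fun p => isClosed_roomClass _ _) (fun p => (isClosed_roomClass _ _).isCompact)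
    (fun j => (T j)ᶜ ∩ (successSet (dd j))ᶜ)
    (fun j ⟨⟨D, s⟩, h1, h2, h3⟩ => by
      obtain ⟨U, hU, hTU⟩ := hG j
      obtain ⟨s', hs', hsub, hdis⟩ := exists_roomClass_disjoint h1 h2 hU (hTU ▸ hTR j) h3
      obtain ⟨D', t, g1, g2, g3, hsub', hbd⟩ :=
        exists_roomClass_bounded h1 h2 (hdd' j).1 (hdd' j).2 hs'
      exact ⟨⟨⟨D', t⟩, g1, g2, g3⟩, hsub'.trans hsub,
        Set.subset_inter (hTU ▸ hsub'.trans hdis) hbd⟩)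
    ⟨⟨fun _ => 0, []⟩, isMartingale_zero, isComputableFun_zero, by simp [HasRoom]⟩
  have hAR : A ∈ RANDcomp := by
    intro d hd hdc
    obtain ⟨i, rfl⟩ := hdd.subset (show d ∈ _ from ⟨hd, hdc⟩)
    exact (hA i).2
  rw [hRT] at hAR
  obtain ⟨i, hi⟩ := Set.mem_iUnion.1 hAR
  exact (hA i).1 hi

/-- The complement of a success set is a countable union of closed classes. -/
lemma boldSigma_three_compl_successSet (d : List Bool → ℝ≥0) :
    BoldSigma 3 (successSet d)ᶜ := by
  refine ⟨fun k => {A | ∀ n, d (A.restr n) ≤ k}, fun k =>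
    ⟨fun n => {A | (k : ℝ≥0) < d (A.restr n)}, fun n => ?_, ?_⟩, ?_⟩
  · exact (Cantor.isClosed_restr_mem (fun w => (k : ℝ≥0) < d w) n).isOpen_compl
  · ext A
    simp
  · ext A
    simp [mem_successSet_iff]

theorem mainTheorem9 :
    LightPi 3 RANDcomp ∧
    ¬ BoldSigma 3 RANDcomp ∧
    ∀ d : List Bool → ℝ≥0, IsSupermartingale d → RANDcomp ≠ (successSet d)ᶜ := by
  refine ⟨lightPi_three_RANDcomp, not_boldSigma_three_RANDcomp, fun d _ h => ?_⟩
  exact not_boldSigma_three_RANDcomp (h ▸ boldSigma_three_compl_successSet d)
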